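/- Let $\mathbb{R}[x_1,\dots,x_n]$ be the real polynomial ring in $n\ge 0$ variables. For an integer $k\ge 0$, a $k$-nomial is a polynomial of the form $\alpha_1m_1+\cdots+\alpha_km_k$ with $\alpha_1,\dots,\alpha_k\in\mathbb{R}$ and monomials $m_1,\dots,m_k$ (equivalently, a polynomial with at most $k$ nonzero terms), and a polynomial is called so$k$s if it is a finite sum of squares of $k$-nomials. Let $G_n=x_1^2+\cdots+x_n^2$. (A) Let $p$ be a real quadratic form in $n$ variables (a homogeneous polynomial of degree 2, possibly zero). Suppose that at least one of the following holds: (1) $p$ is symmetric, i.e. invariant under all permutations of the variables; (2) $k=2$; (3) $n=4$ and $k=3$. Then there exists an integer $r\ge 0$ such that $G_n^r\,p$ is so$k$s if and only if $p$ itself is so$k$s (that is, the existence of such an $r$ is equivalent to $p$ being so$k$s). Moreover, for every fixed integer $r\ge 0$, $G_n^r\,p$ is so$k$s if and only if $p$ is so$k$s. (B) Let $q$ be a real quadratic form in $4$ variables, let $\lambda_1,\dots,\lambda_4$ be real numbers that are not all zero, and let $r\ge 0$ be an integer. Then $(\lambda_1^2x_1^2+\lambda_2^2x_2^2+\lambda_3^2x_3^2+\lambda_4^2x_4^2)^r\,q$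 is a sum of squares of $3$-nomials if and only if $q$ is. -/

import Mathlib

open MvPolynomial

/-- A `k`-nomial: a real polynomial with at most `k` monomials, that is, a linear combination
of `k` monomials. -/
def IsKNomial {n : ℕ} (k : ℕ) (q : MvPolynomial (Fin n) ℝ) : Prop :=
  q.support.card ≤ k

/-- `p` is a (finite) sum of squares of `k`-nomials. -/
def IsSumSqKNomials {n : ℕ} (k : ℕ) (p : MvPolynomial (Fin n) ℝ) : Prop :=
  ∃ (m : ℕ) (q : Fin m → MvPolynomial (Fin n) ℝ),
    (∀ i, IsKNomial k (q i)) ∧ p = ∑ i, q i ^ 2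

/-- The form `x₁² + ⋯ + xₙ²`. -/
noncomputable def sumSqVars (n : ℕ) : MvPolynomial (Fin n) ℝ :=
  ∑ i, X i ^ 2

/-- The weighted form `l₁² x₁² + ⋯ + lₙ² xₙ²`. -/
noncomputable def weightedSumSqVars {n : ℕ} (l : Fin n → ℝ) : MvPolynomial (Fin n) ℝ :=
  ∑ i, C (l i ^ 2) * X i ^ 2

/-! The easy direction holds because $G_n$ and its weighted versions are sums of squares of
monomials, and multiplying a $k$-nomial by a monomial keeps it a $k$-nomial.

The converse is by duality. If the form with symmetric matrix $A$ is not so$k$s, separation yields a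
symmetric $B$ with $\langle A,B\rangle<0$ that is positive on nonzero vectors with at most $k$
nonzero entries (`exists_dual`). Such a $B$ must be turned into a functional on all polynomials.
Write $B_{ij}=x_ix_jb_{ij}$ with $b_{ii}=1$, and send $X_i$ to $x_i[h_i]$ in the group algebra of an
elementary abelian 2-group $H$. Since $2h_i=0$, every diagonal form becomes a scalar, so its powers
cannot change the sign of the functional. If $g:H\to\mathbb{R}$ satisfies $g(h_i+h_j)=b_{ij}$ and
the matrix $(g(s+t))$ has positive semidefinite principal submatrices up to size $k$, then $g$ is
nonnegative on squares of $k$-nomials but negative on the given product, a contradiction.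

It remains to extend $b$ to $g$. For $k=2$, extend by zero on $\mathbb{F}_2^n$. For $n=4$, $k=3$,
take $H=\mathbb{F}_2^3$: a single value is free, and spherical triangle inequalities show that it
can be chosen (`exists_unitDet_nonneg`). For symmetric forms, $B$ is averaged over permutations, and
$g$ takes one value at $0$ and another elsewhere. -/

/-! ### Closure properties of sums of squares of $k$-nomials -/

section SumSqKNomials

variable {n k : ℕ}

theorem IsSumSqKNomials.zero : IsSumSqKNomials k (0 : MvPolynomial (Fin n) ℝ) :=
  ⟨0, Fin.elim0, fun i => i.elim0, by simp⟩

theorem IsSumSqKNomials.add {p q : MvPolynomial (Fin n) ℝ} (hp : IsSumSqKNomials k p)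
    (hq : IsSumSqKNomials k q) : IsSumSqKNomials k (p + q) := by
  obtain ⟨a, f, hf, rfl⟩ := hp
  obtain ⟨b, g, hg, rfl⟩ := hq
  refine ⟨a + b, Fin.append f g, fun i => ?_, ?_⟩
  · induction i using Fin.addCases with
    | left i => simpa using hf i
    | right i => simpa using hg i
  · simp [Fin.sum_univ_add]

theorem IsSumSqKNomials.sum {ι : Type*} (s : Finset ι) (f : ι → MvPolynomial (Fin n) ℝ)
    (h : ∀ i ∈ s, IsSumSqKNomials k (f i)) : IsSumSqKNomials k (∑ i ∈ s, f i) :=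
  Finset.sum_induction f (IsSumSqKNomials k) (fun _ _ => .add) .zero h

theorem IsKNomial.isSumSqKNomials_sq {q : MvPolynomial (Fin n) ℝ} (hq : IsKNomial k q) :
    IsSumSqKNomials k (q ^ 2) :=
  ⟨1, fun _ => q, fun _ => hq, by simp⟩

theorem IsKNomial.monomial_mul {q : MvPolynomial (Fin n) ℝ} (hq : IsKNomial k q)
    (m : Fin n →₀ ℕ) (c : ℝ) : IsKNomial k (monomial m c * q) := by
  classical
  unfold IsKNomial at *
  refine le_trans (Finset.card_le_card (support_mul _ _)) ?_
  refine le_trans Finset.card_add_le ?_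
  calc _ ≤ 1 * q.support.card := by
        gcongr
        exact (Finset.card_le_card support_monomial_subset).trans (by simp)
    _ ≤ k := by simpa using hq

theorem IsSumSqKNomials.monomial_sq_mul {p : MvPolynomial (Fin n) ℝ} (hp : IsSumSqKNomials k p)
    (m : Fin n →₀ ℕ) (c : ℝ) : IsSumSqKNomials k (monomial m c ^ 2 * p) := by
  obtain ⟨a, f, hf, rfl⟩ := hp
  refine ⟨a, fun i => monomial m c * f i, fun i => (hf i).monomial_mul m c, ?_⟩
  simp [Finset.mul_sum, mul_pow]

theorem IsSumSqKNomials.C_mul {p : MvPolynomial (Fin n) ℝ} (hp : IsSumSqKNomials k p)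
    {c : ℝ} (hc : 0 ≤ c) : IsSumSqKNomials k (C c * p) := by
  have := hp.monomial_sq_mul 0 (√c)
  rwa [monomial_zero', ← C_pow, Real.sq_sqrt hc] at this

theorem IsSumSqKNomials.weightedSumSqVars_pow_mul {p : MvPolynomial (Fin n) ℝ}
    (hp : IsSumSqKNomials k p) (l : Fin n → ℝ) (r : ℕ) :
    IsSumSqKNomials k (weightedSumSqVars l ^ r * p) := by
  induction r with
  | zero => simpa using hp
  | succ r ih =>
    rw [pow_succ', mul_assoc]
    nth_rw 1 [weightedSumSqVars]
    rw [Finset.sum_mul]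
    refine .sum _ _ fun i _ => ?_
    convert ih.monomial_sq_mul (Finsupp.single i 1) (l i) using 2
    rw [monomial_eq]
    simp [mul_pow]

theorem IsSumSqKNomials.eq_zero_of_zero {p : MvPolynomial (Fin n) ℝ}
    (hp : IsSumSqKNomials 0 p) : p = 0 := by
  obtain ⟨a, f, hf, rfl⟩ := hp
  refine Finset.sum_eq_zero fun i _ => ?_
  have : f i = 0 := by simpa [IsKNomial] using hf i
  simp [this]

theorem weightedSumSqVars_one : weightedSumSqVars (1 : Fin n → ℝ) = sumSqVars n := by
  simp [weightedSumSqVars, sumSqVars]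

end SumSqKNomials

/-! ### Quadratic forms and their coefficient matrices -/

section QuadForm

variable {n : ℕ}

/-- The quadratic form with (not necessarily symmetric) coefficient matrix `A`. -/
noncomputable def quadForm (A : Fin n → Fin n → ℝ) : MvPolynomial (Fin n) ℝ :=
  ∑ i, ∑ j, C (A i j) * (X i * X j)

theorem quadForm_add (A B : Fin n → Fin n → ℝ) :
    quadForm (A + B) = quadForm A + quadForm B := by
  simp [quadForm, add_mul, Finset.sum_add_distrib]

theorem quadForm_smul (c : ℝ) (A : Fin n → Fin n → ℝ) :
    quadForm (c • A) = C c * quadForm A := by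
  simp [quadForm, Finset.mul_sum, mul_assoc]

theorem quadForm_zero : quadForm (0 : Fin n → Fin n → ℝ) = 0 := by
  simp [quadForm]

theorem quadForm_sum {ι : Type*} (s : Finset ι) (A : ι → Fin n → Fin n → ℝ) :
    quadForm (∑ i ∈ s, A i) = ∑ i ∈ s, quadForm (A i) := by
  classical
  induction s using Finset.induction_on with
  | empty => simp [quadForm_zero]
  | insert a s ha ih => rw [Finset.sum_insert ha, Finset.sum_insert ha, quadForm_add, ih]

theorem quadForm_swap (A : Fin n → Fin n → ℝ) : quadForm (fun i j => A j i) = quadForm A := by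
  rw [quadForm, Finset.sum_comm]
  simp [quadForm, mul_comm]

theorem quadForm_comp_perm (A : Fin n → Fin n → ℝ) (σ : Equiv.Perm (Fin n)) :
    quadForm (fun i j => A (σ i) (σ j)) = rename σ.symm (quadForm A) := by
  simp only [quadForm, map_sum, map_mul, rename_C, rename_X]
  refine (Fintype.sum_equiv σ _ _ fun i => ?_)
  refine (Fintype.sum_equiv σ _ _ fun j => ?_)
  simp

theorem eval_quadForm (A : Fin n → Fin n → ℝ) (x : Fin n → ℝ) :
    eval x (quadForm A) = ∑ i, ∑ j, A i j * (x i * x j) := by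
  simp [quadForm]

theorem quadForm_mul_self (v : Fin n → ℝ) :
    quadForm (fun i j => v i * v j) = (∑ i, C (v i) * X i) ^ 2 := by
  rw [sq, Finset.sum_mul_sum, quadForm]
  refine Finset.sum_congr rfl fun i _ => Finset.sum_congr rfl fun j _ => ?_
  rw [C_mul]; ring

theorem exists_eq_quadForm {p : MvPolynomial (Fin n) ℝ} (hp : p.IsHomogeneous 2) :
    ∃ A : Fin n → Fin n → ℝ, p = quadForm A := by
  classical
  have key : ∀ m ∈ p.support, ∃ A : Fin n → Fin n → ℝ, monomial m (coeff m p) = quadForm A := by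
    intro m hm
    have hdeg : m.degree = 2 := by
      have := hp (mem_support_iff.1 hm)
      rw [Finsupp.degree_eq_weight_one (R := ℕ)]; exact this
    have hcard : (Finsupp.toMultiset m).card = 2 := by
      rw [Finsupp.card_toMultiset, ← hdeg]; rfl
    obtain ⟨i, j, hij⟩ := Multiset.card_eq_two.1 hcard
    have hm' : m = Finsupp.single i 1 + Finsupp.single j 1 := by
      apply Multiset.toFinsupp.symm.injective
      simp [hij]
    refine ⟨fun a b => if a = i ∧ b = j then coeff m p else 0, ?_⟩
    have : quadForm (fun a b => if a = i ∧ b = j then coeff m p else 0)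
        = C (coeff m p) * (X i * X j) := by
      rw [quadForm, Finset.sum_eq_single i, Finset.sum_eq_single j] <;> simp +contextual
    rw [this, X, X, monomial_mul, C_mul_monomial, ← hm']
    simp
  choose! A hA using key
  refine ⟨∑ m ∈ p.support, A m, ?_⟩
  rw [quadForm_sum, ← Finset.sum_congr rfl hA]
  exact p.as_sum

theorem exists_symm_eq_quadForm {p : MvPolynomial (Fin n) ℝ} (hp : p.IsHomogeneous 2) :
    ∃ A : Fin n → Fin n → ℝ, (∀ i j, A i j = A j i) ∧ p = quadForm A := by
  obtain ⟨A, rfl⟩ := exists_eq_quadForm hp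
  refine ⟨(1 / 2 : ℝ) • (A + fun i j => A j i), fun i j => ?_, ?_⟩
  · simp [add_comm]
  · rw [quadForm_smul, quadForm_add, quadForm_swap, ← two_mul, ← mul_assoc,
      ← map_ofNat (C : ℝ →+* MvPolynomial (Fin n) ℝ) 2, ← C_mul]
    simp

/-- Averaging any coefficient matrix over all permutations leaves a symmetric form unchanged. -/
theorem exists_invariant_eq_quadForm {p : MvPolynomial (Fin n) ℝ} (hp : p.IsHomogeneous 2)
    (hs : p.IsSymmetric) :
    ∃ A : Fin n → Fin n → ℝ, (∀ (σ : Equiv.Perm (Fin n)) (i j), A (σ i) (σ j) = A i j) ∧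
      p = quadForm A := by
  obtain ⟨A, rfl⟩ := exists_eq_quadForm hp
  refine ⟨((Fintype.card (Equiv.Perm (Fin n)) : ℝ))⁻¹ •
    ∑ σ : Equiv.Perm (Fin n), fun i j => A (σ i) (σ j), fun τ i j => ?_, ?_⟩
  · simp only [Pi.smul_apply, Finset.sum_apply]
    congr 1
    exact Fintype.sum_equiv (Equiv.mulRight τ) _ _ fun _ => rfl
  · rw [quadForm_smul, quadForm_sum]
    rw [Finset.sum_congr rfl fun σ _ => (quadForm_comp_perm A σ).trans (hs σ.symm), Finset.sum_const, nsmul_eq_mul, ← mul_assoc,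
      Finset.card_univ, ← map_natCast (C : ℝ →+* MvPolynomial (Fin n) ℝ), ← C_mul,
      inv_mul_cancel₀ (by positivity)]
    simp

end QuadForm

/-! ### Compactness of convex hulls in finite dimension -/

section ConvexHullCompact

/-- By Carathéodory, the hull is the continuous image of a simplex times a finite power of $s$. -/
theorem IsCompact.convexHull_of_finiteDimensional {E : Type*} [AddCommGroup E] [Module ℝ E]
    [TopologicalSpace E] [ContinuousAdd E] [ContinuousSMul ℝ E] [FiniteDimensional ℝ E]
    {s : Set E} (hs : IsCompact s) : IsCompact (convexHull ℝ s) := by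
  classical
  set d := Module.finrank ℝ E + 1
  let f : (Fin d → ℝ) × (Fin d → E) → E := fun y => ∑ i, y.1 i • y.2 i
  have hf : Continuous f := by fun_prop
  have hK : IsCompact (stdSimplex ℝ (Fin d) ×ˢ Set.pi Set.univ fun _ : Fin d => s) :=
    (isCompact_stdSimplex ℝ (Fin d)).prod (isCompact_univ_pi fun _ => hs)
  convert hK.image hf
  ext x
  constructor
  · intro hx
    obtain ⟨ι, _, z, w, hz, hai, hw, hw1, rfl⟩ := eq_pos_convex_span_of_mem_convexHull hx
    have hcard : Fintype.card ι ≤ Fintype.card (Fin d) := by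
      rw [Fintype.card_fin]
      exact (hai.card_le_finrank_succ).trans
        (Nat.succ_le_succ (Submodule.finrank_le _))
    obtain ⟨e⟩ := Function.Embedding.nonempty_of_card_le hcard
    obtain ⟨x₀, hx₀⟩ := convexHull_nonempty_iff.1 ⟨_, hx⟩
    have hw0 : ∀ j, j ∉ Set.range e → Function.extend e w (fun _ => 0) j = 0 :=
      fun j hj => Function.extend_apply' w (fun _ => 0) j hj
    -- Fewer than $d$ points are padded with weight $0$ at an arbitrary $x_0\in s$.
    refine ⟨(Function.extend e w fun _ => 0, Function.extend e z fun _ => x₀),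
      ⟨⟨fun j => ?_, ?_⟩, ?_⟩, ?_⟩
    · by_cases hj : ∃ i, e i = j
      · obtain ⟨i, rfl⟩ := hj
        simpa [e.injective.extend_apply] using (hw i).le
      · exact (hw0 j hj).ge
    · rw [← hw1]
      exact (Fintype.sum_of_injective e e.injective _ _ hw0
        fun i => by simp [e.injective.extend_apply]).symm
    · intro j _
      by_cases hj : ∃ i, e i = j
      · obtain ⟨i, rfl⟩ := hj
        simpa [e.injective.extend_apply] using hz ⟨i, rfl⟩
      · simpa [Function.extend_apply' _ _ _ hj] using hx₀
    · exact (Fintype.sum_of_injective e e.injective _ _ (fun j hj => by simp [hw0 j hj])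
        fun i => by simp [e.injective.extend_apply]).symm
  · rintro ⟨⟨w, z⟩, ⟨hw, hz⟩, rfl⟩
    exact (convex_convexHull ℝ s).sum_mem (fun i _ => hw.1 i) hw.2
      fun i _ => subset_convexHull ℝ s (hz i trivial)

end ConvexHullCompact

/-! ### Separation from the cone of so$k$s quadratic forms -/

section Duality

variable {n k : ℕ}

theorem isClosed_card_support_le (n k : ℕ) :
    IsClosed {v : Fin n → ℝ | (Finset.univ.filter fun i => v i ≠ 0).card ≤ k} := by
  have : {v : Fin n → ℝ | (Finset.univ.filter fun i => v i ≠ 0).card ≤ k}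
      = ⋃ S ∈ {S : Finset (Fin n) | S.card ≤ k}, {v | ∀ i, i ∉ S → v i = 0} := by
    ext v
    simp only [Set.mem_ofPred_eq, Set.mem_iUnion, exists_prop]
    constructor
    · exact fun h => ⟨_, h, by simp⟩
    · rintro ⟨S, hS, hv⟩
      refine (Finset.card_le_card fun i hi => ?_).trans hS
      by_contra h
      simp [hv i h] at hi
  rw [this]
  refine (Set.toFinite _).isClosed_biUnion fun S _ => ?_
  simp only [Set.ofPred_forall]
  exact isClosed_iInter fun i => isClosed_iInter fun _ =>
    isClosed_eq (continuous_apply i) continuous_const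

/-- The unit vectors with at most `k` nonzero coordinates. -/
def sparseSphere (n k : ℕ) : Set (Fin n → ℝ) :=
  {v | ∑ i, v i ^ 2 = 1 ∧ (Finset.univ.filter fun i => v i ≠ 0).card ≤ k}

theorem isCompact_sparseSphere (n k : ℕ) : IsCompact (sparseSphere n k) := by
  refine Metric.isCompact_of_isClosed_isBounded ?_ ?_
  · exact (isClosed_eq (by fun_prop) continuous_const).inter (isClosed_card_support_le n k)
  · refine (Metric.isBounded_closedBall (x := (0 : Fin n → ℝ)) (r := 1)).subset fun v hv => ?_
    rw [mem_closedBall_zero_iff, pi_norm_le_iff_of_nonneg zero_le_one]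
    intro i
    rw [Real.norm_eq_abs, ← sq_le_one_iff_abs_le_one, ← hv.1]
    exact Finset.single_le_sum (f := fun i => v i ^ 2) (fun i _ => sq_nonneg _) (Finset.mem_univ i)

theorem isKNomial_linear {v : Fin n → ℝ} (hv : (Finset.univ.filter fun i => v i ≠ 0).card ≤ k) :
    IsKNomial k (∑ i, C (v i) * X i) := by
  classical
  refine le_trans (Finset.card_le_card (t := (Finset.univ.filter fun i => v i ≠ 0).image
    fun i => Finsupp.single i 1) ?_) (Finset.card_image_le.trans hv)
  intro m hm
  obtain ⟨i, -, hi⟩ := Finset.mem_biUnion.1 (support_sum hm)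
  rw [C_mul_X_eq_monomial, support_monomial] at hi
  split_ifs at hi with h
  · simp at hi
  · exact Finset.mem_image.2 ⟨i, by simpa using h, (Finset.mem_singleton.1 hi).symm⟩

theorem isSumSqKNomials_quadForm_of_mem_convexHull {A : Fin n → Fin n → ℝ}
    (hA : A ∈ convexHull ℝ ((fun (v : Fin n → ℝ) i j => v i * v j) '' sparseSphere n k)) :
    IsSumSqKNomials k (quadForm A) := by
  suffices h : convexHull ℝ ((fun (v : Fin n → ℝ) i j => v i * v j) '' sparseSphere n k)
      ⊆ {A | IsSumSqKNomials k (quadForm A)} from h hA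
  refine convexHull_min ?_ ?_
  · rintro _ ⟨v, hv, rfl⟩
    change IsSumSqKNomials k (quadForm fun i j => v i * v j)
    rw [quadForm_mul_self]
    exact (isKNomial_linear hv.2).isSumSqKNomials_sq
  · intro A hA B hB a b ha hb _
    change IsSumSqKNomials k (quadForm (a • A + b • B))
    rw [quadForm_add, quadForm_smul, quadForm_smul]
    exact (hA.C_mul ha).add (hB.C_mul hb)

/-- Perturb the identity: $B=I-A/(s+1)$ with $s=\|A\|^2$. On unit vectors $A$ is at most $(s+1)/2$,
so $B\ge 1/2$ there, while $\langle A,B\rangle=\operatorname{tr}A-s/(s+1)<0$. -/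
theorem exists_dual_of_trace_nonpos {A : Fin n → Fin n → ℝ} (h0 : A ≠ 0)
    (hsymm : ∀ i j, A i j = A j i) (htr : ∑ i, A i i ≤ 0) :
    ∃ B : Fin n → Fin n → ℝ, (∀ i j, B i j = B j i) ∧
      (∀ v : Fin n → ℝ, ∑ i, v i ^ 2 = 1 → 0 < ∑ i, ∑ j, B i j * (v i * v j)) ∧
      ∑ i, ∑ j, A i j * B i j < 0 := by
  set s := ∑ i, ∑ j, A i j ^ 2 with hs
  have hs0 : 0 < s := by
    refine lt_of_le_of_ne (by positivity) fun h => h0 ?_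
    rw [hs, eq_comm, Finset.sum_eq_zero_iff_of_nonneg fun _ _ => by positivity] at h
    ext i j
    have := (Finset.sum_eq_zero_iff_of_nonneg fun _ _ => by positivity).1 (h i (Finset.mem_univ i))
      j (Finset.mem_univ j)
    simpa using this
  refine ⟨fun i j => (if i = j then 1 else 0) - (s + 1)⁻¹ * A i j, fun i j => ?_,
    fun v hv => ?_, ?_⟩
  · simp only [hsymm i j, eq_comm]
  · have h1 : ∑ i, ∑ j, A i j * (v i * v j) ≤ (s + 1) / 2 := by
      calc ∑ i, ∑ j, A i j * (v i * v j)
          ≤ ∑ i, ∑ j, (A i j ^ 2 + v i ^ 2 * v j ^ 2) / 2 := by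
            gcongr with i _ j _
            nlinarith [sq_nonneg (A i j - v i * v j)]
        _ = (s + (∑ i, v i ^ 2) * ∑ j, v j ^ 2) / 2 := by
            rw [Finset.sum_mul_sum]
            simp only [← Finset.sum_div, Finset.sum_add_distrib, hs]
        _ = (s + 1) / 2 := by rw [hv]; ring
    have h2 : ∑ i, ∑ j, ((if i = j then 1 else 0) - (s + 1)⁻¹ * A i j) * (v i * v j)
        = ∑ i, v i ^ 2 - (s + 1)⁻¹ * ∑ i, ∑ j, A i j * (v i * v j) := by
      simp only [sub_mul, Finset.sum_sub_distrib, ite_mul, one_mul, zero_mul, Finset.sum_ite_eq,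
        Finset.mem_univ, if_true, Finset.mul_sum, mul_assoc, sq]
    rw [h2, hv]
    have : (s + 1)⁻¹ * ∑ i, ∑ j, A i j * (v i * v j) ≤ (s + 1)⁻¹ * ((s + 1) / 2) := by gcongr
    have h3 : (s + 1)⁻¹ * ((s + 1) / 2) = 1 / 2 := by field_simp
    linarith
  · have : ∑ i, ∑ j, A i j * ((if i = j then 1 else 0) - (s + 1)⁻¹ * A i j)
        = ∑ i, A i i - (s + 1)⁻¹ * s := by
      simp only [mul_sub, Finset.sum_sub_distrib, mul_ite, mul_one, mul_zero, Finset.sum_ite_eq,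
        Finset.mem_univ, if_true, hs, Finset.mul_sum]
      congr 1
      refine Finset.sum_congr rfl fun i _ => Finset.sum_congr rfl fun j _ => by ring
    rw [this]
    have : 0 < (s + 1)⁻¹ * s := by positivity
    linarith

/-- The matrices $vv^T$ with $v$ a sparse unit vector have trace $1$ and a compact convex hull, from
which $A/\operatorname{tr}A$ can be strictly separated. -/
theorem exists_dual_of_trace_pos {A : Fin n → Fin n → ℝ} (hsymm : ∀ i j, A i j = A j i)
    (htr : 0 < ∑ i, A i i) (hA : ¬ IsSumSqKNomials k (quadForm A)) :
    ∃ B : Fin n → Fin n → ℝ, (∀ i j, B i j = B j i) ∧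
      (∀ v ∈ sparseSphere n k, 0 < ∑ i, ∑ j, B i j * (v i * v j)) ∧
      ∑ i, ∑ j, A i j * B i j < 0 := by
  classical
  set t := ∑ i, A i i with ht
  set T := (fun (v : Fin n → ℝ) i j => v i * v j) '' sparseSphere n k with hT
  have hTc : IsCompact (convexHull ℝ T) :=
    ((isCompact_sparseSphere n k).image (by fun_prop)).convexHull_of_finiteDimensional
  have hnot : t⁻¹ • A ∉ convexHull ℝ T := fun h => hA <| by
    have := (isSumSqKNomials_quadForm_of_mem_convexHull h).C_mul htr.le
    rwa [← quadForm_smul, smul_smul, mul_inv_cancel₀ htr.ne', one_smul] at this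
  obtain ⟨f, u, hfA, hfT⟩ :=
    geometric_hahn_banach_point_closed (convex_convexHull ℝ T) hTc.isClosed hnot
  let D : Fin n → Fin n → ℝ := fun i j => f (Pi.single i (Pi.single j 1))
  have hf : ∀ M : Fin n → Fin n → ℝ, f M = ∑ i, ∑ j, M i j * D i j := by
    intro M
    have : M = ∑ i, ∑ j, M i j • (Pi.single i (Pi.single j 1) : Fin n → Fin n → ℝ) := by
      ext a b
      simp [Finset.sum_apply, Pi.single_apply, ite_apply]
    conv_lhs => rw [this]
    simp only [map_sum, map_smul, smul_eq_mul, D]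
  -- Subtracting $u$ times the identity moves the separating threshold to $0$, as $\sum v_i^2=1$;
  -- symmetrizing $D$ does not affect pairings with symmetric matrices.
  refine ⟨fun i j => (D i j + D j i) / 2 - if i = j then u else 0, fun i j => ?_,
    fun v hv => ?_, ?_⟩
  · simp only [eq_comm, add_comm]
  · have h1 := hfT _ (subset_convexHull ℝ T ⟨v, hv, rfl⟩)
    rw [hf] at h1
    have h2 : ∑ i, ∑ j, v i * v j * D j i = ∑ i, ∑ j, v i * v j * D i j := by
      rw [Finset.sum_comm]
      exact Finset.sum_congr rfl fun i _ => Finset.sum_congr rfl fun j _ => by ring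
    have h3 : ∑ i, ∑ j, ((D i j + D j i) / 2 - if i = j then u else 0) * (v i * v j)
        = (∑ i, ∑ j, v i * v j * D i j + ∑ i, ∑ j, v i * v j * D j i) / 2
          - u * ∑ i, v i ^ 2 := by
      simp only [sub_mul, Finset.sum_sub_distrib, ite_mul, zero_mul, Finset.sum_ite_eq,
        Finset.mem_univ, if_true, ← Finset.sum_add_distrib, Finset.sum_div, Finset.mul_sum]
      congr 1
      · exact Finset.sum_congr rfl fun i _ => Finset.sum_congr rfl fun j _ => by ring
      · exact Finset.sum_congr rfl fun i _ => by ring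
    rw [h3, h2, hv.1]
    linarith
  · have h1 : f A < t * u := by
      rw [map_smul, smul_eq_mul, inv_mul_lt_iff₀ htr] at hfA
      exact hfA
    rw [hf] at h1
    have h2 : ∑ i, ∑ j, A i j * D j i = ∑ i, ∑ j, A i j * D i j := by
      rw [Finset.sum_comm]
      exact Finset.sum_congr rfl fun i _ => Finset.sum_congr rfl fun j _ => by rw [hsymm]
    have h3 : ∑ i, ∑ j, A i j * ((D i j + D j i) / 2 - if i = j then u else 0)
        = (∑ i, ∑ j, A i j * D i j + ∑ i, ∑ j, A i j * D j i) / 2 - t * u := by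
      simp only [mul_sub, Finset.sum_sub_distrib, mul_ite, mul_zero, Finset.sum_ite_eq,
        Finset.mem_univ, if_true, ← Finset.sum_add_distrib, Finset.sum_div, Finset.sum_mul, ht]
      congr 1
      exact Finset.sum_congr rfl fun i _ => Finset.sum_congr rfl fun j _ => by ring
    rw [h3, h2]
    linarith

theorem exists_dual {A : Fin n → Fin n → ℝ} (hsymm : ∀ i j, A i j = A j i)
    (hA : ¬ IsSumSqKNomials k (quadForm A)) :
    ∃ B : Fin n → Fin n → ℝ, (∀ i j, B i j = B j i) ∧
      (∀ v : Fin n → ℝ, v ≠ 0 → (Finset.univ.filter fun i => v i ≠ 0).card ≤ k →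
        0 < ∑ i, ∑ j, B i j * (v i * v j)) ∧
      ∑ i, ∑ j, A i j * B i j < 0 := by
  have h0 : A ≠ 0 := by
    rintro rfl
    exact hA (by simpa [quadForm_zero] using IsSumSqKNomials.zero)
  obtain ⟨B, hB, hpos, hneg⟩ : ∃ B : Fin n → Fin n → ℝ, (∀ i j, B i j = B j i) ∧
      (∀ v ∈ sparseSphere n k, 0 < ∑ i, ∑ j, B i j * (v i * v j)) ∧
      ∑ i, ∑ j, A i j * B i j < 0 := by
    rcases le_or_gt (∑ i, A i i) 0 with h | h
    · obtain ⟨B, h1, h2, h3⟩ := exists_dual_of_trace_nonpos h0 hsymm h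
      exact ⟨B, h1, fun v hv => h2 v hv.1, h3⟩
    · exact exists_dual_of_trace_pos hsymm h hA
  refine ⟨B, hB, fun v hv hc => ?_, hneg⟩
  set s := ∑ i, v i ^ 2 with hs
  have hs0 : 0 < s := by
    obtain ⟨i, hi⟩ := Function.ne_iff.1 hv
    exact Finset.sum_pos' (fun _ _ => sq_nonneg _) ⟨i, Finset.mem_univ i, by
      have : v i ≠ 0 := hi
      positivity⟩
  have hq : (√s)⁻¹ * (√s)⁻¹ = s⁻¹ := by
    rw [← mul_inv, Real.mul_self_sqrt hs0.le]
  have := hpos (fun i => (√s)⁻¹ * v i) ⟨?_, ?_⟩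
  · have h2 : ∑ i, ∑ j, B i j * ((√s)⁻¹ * v i * ((√s)⁻¹ * v j))
        = s⁻¹ * ∑ i, ∑ j, B i j * (v i * v j) := by
      simp only [Finset.mul_sum, ← hq]
      exact Finset.sum_congr rfl fun i _ => Finset.sum_congr rfl fun j _ => by ring
    rw [h2] at this
    exact (pos_iff_pos_of_mul_pos this).1 (inv_pos.2 hs0)
  · simp only [mul_pow, ← Finset.mul_sum]
    rw [← hs, sq, hq, inv_mul_cancel₀ hs0.ne']
  · simpa [hs0.ne', (Real.sqrt_pos.2 hs0).ne'] using hc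

end Duality

/-! ### Functionals from functions on a 2-group -/

section Obstruction

variable {n k : ℕ} {H : Type*} [AddCommGroup H]

/-- All principal submatrices of size at most `k` of the matrix `g (a + b)` indexed by `H` are
positive semidefinite. -/
def IsSparsePSD (k : ℕ) (g : H → ℝ) : Prop :=
  ∀ (S : Finset H) (a : H → ℝ), S.card ≤ k →
    0 ≤ ∑ s ∈ S, ∑ t ∈ S, a s * a t * g (s + t)

/-- Evaluation at `x`, graded by `H` with the variable `X i` in degree `h i`. -/
noncomputable def gradedEval (h : Fin n → H) (x : Fin n → ℝ) :
    MvPolynomial (Fin n) ℝ →ₐ[ℝ] AddMonoidAlgebra ℝ H :=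
  aeval fun i => AddMonoidAlgebra.single (h i) (x i)

/-- The linear functional on the group algebra of `H` with values `g` on the basis `H`. -/
noncomputable def pairing (g : H → ℝ) : AddMonoidAlgebra ℝ H →+ ℝ :=
  (Finsupp.liftAddHom fun a => AddMonoidHom.mulRight (g a)).comp
    AddMonoidAlgebra.coeffAddEquiv.toAddMonoidHom

theorem pairing_single {H : Type*} (g : H → ℝ) (a : H) (c : ℝ) :
    pairing g (AddMonoidAlgebra.single a c) = c * g a := by
  change (Finsupp.single a c).sum (fun b d => d * g b) = c * g a
  simp

theorem exists_gradedEval_eq_sum {q : MvPolynomial (Fin n) ℝ} (hq : IsKNomial k q) (h : Fin n → H)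
    (x : Fin n → ℝ) : ∃ (S : Finset H) (a : H → ℝ), S.card ≤ k ∧
      gradedEval h x q = ∑ s ∈ S, AddMonoidAlgebra.single s (a s) := by
  classical
  have hmon : ∀ m c, ∃ (b : H) (d : ℝ),
      gradedEval h x (monomial m c) = AddMonoidAlgebra.single b d := by
    intro m c
    induction m using Finsupp.induction_linear generalizing c with
    | zero =>
      refine ⟨0, c, ?_⟩
      rw [monomial_zero', gradedEval, aeval_C]
      rfl
    | add m₁ m₂ h₁ h₂ =>
      obtain ⟨b₁, d₁, e₁⟩ := h₁ c
      obtain ⟨b₂, d₂, e₂⟩ := h₂ 1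
      refine ⟨b₁ + b₂, d₁ * d₂, ?_⟩
      rw [← AddMonoidAlgebra.single_mul_single, ← e₁, ← e₂, ← map_mul, monomial_mul, mul_one]
    | single i e =>
      refine ⟨e • h i, c * x i ^ e, ?_⟩
      rw [← C_mul_X_pow_eq_monomial, gradedEval, map_mul, map_pow, aeval_C, aeval_X,
        AddMonoidAlgebra.single_pow, ← Algebra.smul_def, AddMonoidAlgebra.smul_single, smul_eq_mul]
  choose b d hbd using hmon
  let β : (Fin n →₀ ℕ) → H := fun m => b m (coeff m q)
  refine ⟨q.support.image β, fun s => ∑ m ∈ q.support with β m = s, d m (coeff m q),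
    Finset.card_image_le.trans hq, ?_⟩
  conv_lhs => rw [q.as_sum, map_sum, ← Finset.sum_fiberwise_of_maps_to
    (fun m hm => Finset.mem_image_of_mem β hm)]
  refine Finset.sum_congr rfl fun s _ => ?_
  rw [← AddMonoidAlgebra.singleAddHom_apply, map_sum]
  refine Finset.sum_congr rfl fun m hm => ?_
  rw [hbd, ← (Finset.mem_filter.1 hm).2]
  rfl

/-- A $k$-nomial maps to an element $\sum a_s[s]$ with at most $k$ terms, and its square pairs with
$g$ to $\sum a_sa_tg(s+t)$. -/
theorem pairing_gradedEval_nonneg {f : MvPolynomial (Fin n) ℝ} (hf : IsSumSqKNomials k f)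
    {g : H → ℝ} (hg : IsSparsePSD k g) (h : Fin n → H) (x : Fin n → ℝ) :
    0 ≤ pairing g (gradedEval h x f) := by
  obtain ⟨m, q, hq, rfl⟩ := hf
  rw [map_sum, map_sum]
  refine Finset.sum_nonneg fun i _ => ?_
  obtain ⟨S, a, hS, hqS⟩ := exists_gradedEval_eq_sum (hq i) h x
  rw [map_pow, hqS, sq, Finset.sum_mul_sum, map_sum]
  simp only [map_sum, AddMonoidAlgebra.single_mul_single, pairing_single]
  exact hg S a hS

theorem gradedEval_weightedSumSqVars (l : Fin n → ℝ) {h : Fin n → H} (hh : ∀ i, h i + h i = 0)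
    (x : Fin n → ℝ) :
    gradedEval h x (weightedSumSqVars l)
      = algebraMap ℝ _ (∑ i, l i ^ 2 * x i ^ 2) := by
  simp only [gradedEval, weightedSumSqVars, map_sum, map_mul, map_pow, aeval_C, aeval_X]
  refine Finset.sum_congr rfl fun i _ => ?_
  congr 1
  rw [AddMonoidAlgebra.single_pow, two_nsmul, hh, ← map_pow]
  rfl

theorem pairing_gradedEval_quadForm (A : Fin n → Fin n → ℝ) (g : H → ℝ) (h : Fin n → H)
    (x : Fin n → ℝ) :
    pairing g (gradedEval h x (quadForm A)) = ∑ i, ∑ j, A i j * (x i * x j * g (h i + h j)) := by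
  simp only [gradedEval, quadForm, map_sum, map_mul, aeval_C, aeval_X,
    AddMonoidAlgebra.single_mul_single, ← Algebra.smul_def, AddMonoidAlgebra.smul_single,
    pairing_single, smul_eq_mul, mul_assoc]

/-- The diagonal form maps to a positive scalar, which can be cancelled. -/
theorem IsSparsePSD.sum_nonneg {g : H → ℝ} (hg : IsSparsePSD k g) {h : Fin n → H}
    (hh : ∀ i, h i + h i = 0) {x l : Fin n → ℝ} (hx : ∀ i, 0 < x i) (hl : l ≠ 0) {r : ℕ}
    {A : Fin n → Fin n → ℝ} (hA : IsSumSqKNomials k (weightedSumSqVars l ^ r * quadForm A)) :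
    0 ≤ ∑ i, ∑ j, A i j * (x i * x j * g (h i + h j)) := by
  have hW : 0 < ∑ i, l i ^ 2 * x i ^ 2 := by
    obtain ⟨i, hi⟩ := Function.ne_iff.1 hl
    refine Finset.sum_pos' (fun _ _ => by positivity) ⟨i, Finset.mem_univ i, ?_⟩
    have h1 : l i ≠ 0 := hi
    have h2 := hx i
    positivity
  have := pairing_gradedEval_nonneg hA hg h x
  rw [map_mul, map_pow, gradedEval_weightedSumSqVars l hh, ← map_pow] at this
  set w := (∑ i, l i ^ 2 * x i ^ 2) ^ r with hw
  have hw0 : 0 < w := pow_pos hW r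
  have hscale : algebraMap ℝ (AddMonoidAlgebra ℝ H) w * gradedEval h x (quadForm A)
      = gradedEval h x (quadForm (w • A)) := by
    rw [quadForm_smul, map_mul]
    congr 1
    rw [gradedEval, aeval_C]
  rw [hscale, pairing_gradedEval_quadForm] at this
  simp only [Pi.smul_apply, smul_eq_mul, mul_assoc, ← Finset.mul_sum] at this
  simpa only [mul_assoc] using (mul_nonneg_iff_of_pos_left hw0).1 this

end Obstruction

/-! ### Positivity of $2\times2$ and $3\times3$ matrices -/

section SmallPSD

theorem binary_form_nonneg {P Q R : ℝ} (hP : 0 ≤ P) (hQ : 0 ≤ Q) (hR : R ^ 2 ≤ P * Q) (b c : ℝ) :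
    0 ≤ P * b ^ 2 + Q * c ^ 2 + 2 * R * b * c := by
  rcases hP.eq_or_lt with rfl | hP
  · have : R = 0 := by nlinarith [sq_nonneg R]
    subst this
    nlinarith [mul_nonneg hQ (sq_nonneg c)]
  · refine (mul_nonneg_iff_of_pos_left hP).1 ?_
    nlinarith [sq_nonneg (P * b + R * c), mul_nonneg (sub_nonneg.2 hR) (sq_nonneg c)]

/-- The determinant of the symmetric matrix with unit diagonal and off-diagonal entries
`u`, `v`, `w`. -/
def unitDet (u v w : ℝ) : ℝ := 1 + 2 * u * v * w - u ^ 2 - v ^ 2 - w ^ 2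

/-- Complete the square in $a$; the Schur complement has determinant `unitDet u v w`. -/
theorem ternary_form_nonneg {u v w : ℝ} (hu : |u| ≤ 1) (hv : |v| ≤ 1) (h : 0 ≤ unitDet u v w)
    (a b c : ℝ) : 0 ≤ a ^ 2 + b ^ 2 + c ^ 2 + 2 * u * a * b + 2 * v * a * c + 2 * w * b * c := by
  have hu2 := (sq_le_one_iff_abs_le_one u).2 hu
  have hv2 := (sq_le_one_iff_abs_le_one v).2 hv
  have := binary_form_nonneg (P := 1 - u ^ 2) (Q := 1 - v ^ 2) (R := w - u * v)
    (by linarith) (by linarith) (by unfold unitDet at h; nlinarith) b c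
  nlinarith [sq_nonneg (a + u * b + v * c)]

theorem unitDet_nonneg_of_form {u v w : ℝ} (hu : |u| < 1)
    (h : ∀ a b c : ℝ, 0 ≤ a ^ 2 + b ^ 2 + c ^ 2 + 2 * u * a * b + 2 * v * a * c + 2 * w * b * c) :
    0 ≤ unitDet u v w := by
  have hu2 := (sq_lt_one_iff_abs_lt_one u).2 hu
  -- Evaluate the form at the last column of the adjugate: the value is $(1-u^2)$ times the
  -- determinant.
  refine (mul_nonneg_iff_of_pos_left (show 0 < 1 - u ^ 2 by linarith)).1 ?_
  refine (h (u * w - v) (u * v - w) (1 - u ^ 2)).trans_eq ?_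
  unfold unitDet
  ring

variable {H : Type*} [AddCommGroup H]

theorem isSparsePSD_two {g : H → ℝ} (h2 : ∀ a : H, a + a = 0) (h0 : g 0 = 1)
    (hg : ∀ a, |g a| ≤ 1) : IsSparsePSD 2 g := by
  classical
  intro S a hS
  interval_cases hc : S.card
  · rw [Finset.card_eq_zero.1 hc]; simp
  · obtain ⟨s, rfl⟩ := Finset.card_eq_one.1 hc
    simp [h2, h0, mul_self_nonneg]
  · obtain ⟨s, t, hst, rfl⟩ := Finset.card_eq_two.1 hc
    rw [Finset.sum_pair hst, Finset.sum_pair hst, Finset.sum_pair hst, h2, h2, h0, add_comm t s]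
    have := binary_form_nonneg (P := 1) (Q := 1) zero_le_one zero_le_one
      (by simpa using hg (s + t)) (a s) (a t)
    linarith

/-- In a 2-group, $(r+s)+(r+t)=s+t$, so the entries of a $3\times3$ submatrix have indices $a$, $b$,
$a+b$. -/
theorem isSparsePSD_three {g : H → ℝ} (h2 : ∀ a : H, a + a = 0) (h0 : g 0 = 1)
    (hg : ∀ a, |g a| ≤ 1) (hdet : ∀ a b, 0 ≤ unitDet (g a) (g b) (g (a + b))) :
    IsSparsePSD 3 g := by
  classical
  intro S a hS
  rcases hS.lt_or_eq with hS | hS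
  · exact isSparsePSD_two h2 h0 hg S a (Nat.le_of_lt_succ hS)
  · obtain ⟨r, s, t, hrs, hrt, hst, rfl⟩ := Finset.card_eq_three.1 hS
    have hsum : ∀ f : H → ℝ, ∑ x ∈ {r, s, t}, f x = f r + f s + f t := fun f => by
      rw [Finset.sum_insert (by simp [hrs, hrt]), Finset.sum_pair hst, add_assoc]
    have e : r + s + (r + t) = s + t := by
      rw [add_add_add_comm, h2, zero_add]
    have := ternary_form_nonneg (hg (r + s)) (hg (r + t)) (e ▸ hdet (r + s) (r + t))
      (a r) (a s) (a t)
    simp only [hsum, h2, h0, add_comm s r, add_comm t r, add_comm t s]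
    linarith

end SmallPSD

/-! ### Spherical triangles and the choice of the free value -/

section Angles

open Real

theorem unitDet_cos (α β t : ℝ) :
    unitDet (cos α) (cos β) t = (t - cos (α + β)) * (cos (α - β) - t) := by
  rw [unitDet, cos_add, cos_sub]
  have h1 := sin_sq_add_cos_sq α
  have h2 := sin_sq_add_cos_sq β
  have : (sin α * sin β) ^ 2 = (1 - cos α ^ 2) * (1 - cos β ^ 2) := by
    rw [← eq_sub_iff_add_eq] at h1 h2
    rw [mul_pow, h1, h2]
  linear_combination (-1 : ℝ) * this

/-- The matrix is a Gram matrix of unit vectors at angles $\alpha,\beta,\gamma$, and these are the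
side inequalities of a spherical triangle. They follow from the factorization in `unitDet_cos`. -/
theorem triangle_of_unitDet_nonneg {α β γ : ℝ} (hα : α ∈ Set.Icc 0 π) (hβ : β ∈ Set.Icc 0 π)
    (hγ : γ ∈ Set.Icc 0 π) (h : 0 ≤ unitDet (cos α) (cos β) (cos γ)) :
    γ ≤ α + β ∧ α + β + γ ≤ 2 * π := by
  obtain ⟨hα0, hα1⟩ := hα
  obtain ⟨hβ0, hβ1⟩ := hβ
  obtain ⟨hγ0, hγ1⟩ := hγ
  rw [unitDet_cos] at h
  have hle : cos (α + β) ≤ cos (α - β) := by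
    rw [cos_add, cos_sub]
    have := mul_nonneg (sin_nonneg_of_nonneg_of_le_pi hα0 hα1)
      (sin_nonneg_of_nonneg_of_le_pi hβ0 hβ1)
    linarith
  have key : cos (α + β) ≤ cos γ := by
    by_contra! hlt
    nlinarith [mul_pos (sub_pos.2 hlt) (sub_pos.2 (hlt.trans_le hle))]
  constructor
  · by_contra! hlt
    exact key.not_gt (cos_lt_cos_of_nonneg_of_le_pi (by linarith) hγ1 hlt)
  · by_contra! hlt
    have h1 : cos γ < cos (2 * π - (α + β)) :=
      cos_lt_cos_of_nonneg_of_le_pi (by linarith) hγ1 (by linarith)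
    rw [cos_two_pi_sub] at h1
    exact key.not_gt h1

theorem cos_add_le_cos_sub {α β γ δ : ℝ} (h₁ : |γ - δ| ≤ α + β)
    (h₂ : α + β + |γ - δ| ≤ 2 * π) : cos (α + β) ≤ cos (γ - δ) := by
  rw [← cos_abs (γ - δ)]
  have h0 := abs_nonneg (γ - δ)
  rcases le_total (α + β) π with h | h
  · exact cos_le_cos_of_nonneg_of_le_pi h0 h h₁
  · rw [← cos_two_pi_sub (α + β)]
    exact cos_le_cos_of_nonneg_of_le_pi h0 (by linarith) (by linarith)

/-- Each condition confines $t$ to an interval such as $[\cos(p+p'),\cos(p-p')]$. Chaining the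
triangle inequalities of the four given triples shows that the intervals meet pairwise, so they
share a point (Helly on the line). -/
theorem exists_unitDet_nonneg_of_angles {p q r p' q' r' : ℝ}
    (hp : p ∈ Set.Icc 0 π) (hq : q ∈ Set.Icc 0 π) (hr : r ∈ Set.Icc 0 π)
    (hp' : p' ∈ Set.Icc 0 π) (hq' : q' ∈ Set.Icc 0 π) (hr' : r' ∈ Set.Icc 0 π)
    (h₁ : 0 ≤ unitDet (cos p) (cos q) (cos r')) (h₂ : 0 ≤ unitDet (cos p) (cos r) (cos q'))
    (h₃ : 0 ≤ unitDet (cos q) (cos r) (cos p')) (h₄ : 0 ≤ unitDet (cos p') (cos q') (cos r')) :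
    ∃ t, |t| ≤ 1 ∧ 0 ≤ unitDet (cos p) (cos p') t ∧ 0 ≤ unitDet (cos q) (cos q') t ∧
      0 ≤ unitDet (cos r) (cos r') t := by
  have swap₁ : ∀ u v w, unitDet u v w = unitDet u w v := fun u v w => by unfold unitDet; ring
  have swap₂ : ∀ u v w, unitDet u v w = unitDet w v u := fun u v w => by unfold unitDet; ring
  have full : ∀ {a b c : ℝ}, a ∈ Set.Icc 0 π → b ∈ Set.Icc 0 π → c ∈ Set.Icc 0 π →
      0 ≤ unitDet (cos a) (cos b) (cos c) →
      c ≤ a + b ∧ b ≤ a + c ∧ a ≤ b + c ∧ a + b + c ≤ 2 * π := by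
    intro a b c ha hb hc h
    have e₁ := triangle_of_unitDet_nonneg ha hb hc h
    have e₂ := triangle_of_unitDet_nonneg ha hc hb (by rwa [swap₁] at h)
    have e₃ := triangle_of_unitDet_nonneg hc hb ha (by rwa [swap₂] at h)
    exact ⟨e₁.1, e₂.1, by linarith [e₃.1], e₁.2⟩
  obtain ⟨a₁, a₂, a₃, a₄⟩ := full hp hq hr' h₁
  obtain ⟨b₁, b₂, b₃, b₄⟩ := full hp hr hq' h₂
  obtain ⟨c₁, c₂, c₃, c₄⟩ := full hq hr hp' h₃
  obtain ⟨d₁, d₂, d₃, d₄⟩ := full hp' hq' hr' h₄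
  obtain ⟨hp0, hp1⟩ := hp
  obtain ⟨hq0, hq1⟩ := hq
  obtain ⟨hr0, hr1⟩ := hr
  obtain ⟨hp0', hp1'⟩ := hp'
  obtain ⟨hq0', hq1'⟩ := hq'
  obtain ⟨hr0', hr1'⟩ := hr'
  have meet : ∀ {α β γ δ : ℝ}, γ ≤ α + β + δ → δ ≤ α + β + γ → α + β + γ ≤ 2 * π + δ →
      α + β + δ ≤ 2 * π + γ → cos (α + β) ≤ cos (γ - δ) := by
    intro α β γ δ e₁ e₂ e₃ e₄
    refine cos_add_le_cos_sub ?_ ?_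
    · rw [abs_le]; constructor <;> linarith
    · rcases abs_cases (γ - δ) with ⟨e, -⟩ | ⟨e, -⟩ <;> rw [e] <;> linarith
  -- The largest of the left endpoints lies in all three intervals.
  refine ⟨max (cos (p + p')) (max (cos (q + q')) (cos (r + r'))), ?_, ?_, ?_, ?_⟩
  · rw [abs_le]
    exact ⟨(neg_one_le_cos _).trans (le_max_left _ _),
      max_le (cos_le_one _) (max_le (cos_le_one _) (cos_le_one _))⟩
  · rw [unitDet_cos]
    refine mul_nonneg (sub_nonneg.2 (le_max_left _ _)) (sub_nonneg.2 (max_le ?_ (max_le ?_ ?_))) <;>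
    apply meet <;> linarith
  · rw [unitDet_cos]
    refine mul_nonneg (sub_nonneg.2 (le_max_of_le_right (le_max_left _ _)))
      (sub_nonneg.2 (max_le ?_ (max_le ?_ ?_))) <;>
    apply meet <;> linarith
  · rw [unitDet_cos]
    refine mul_nonneg (sub_nonneg.2 (le_max_of_le_right (le_max_right _ _)))
      (sub_nonneg.2 (max_le ?_ (max_le ?_ ?_))) <;>
    apply meet <;> linarith

theorem exists_unitDet_nonneg {p q r p' q' r' : ℝ} (hp : |p| ≤ 1) (hq : |q| ≤ 1) (hr : |r| ≤ 1)
    (hp' : |p'| ≤ 1) (hq' : |q'| ≤ 1) (hr' : |r'| ≤ 1) (h₁ : 0 ≤ unitDet p q r')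
    (h₂ : 0 ≤ unitDet p r q') (h₃ : 0 ≤ unitDet q r p') (h₄ : 0 ≤ unitDet p' q' r') :
    ∃ t, |t| ≤ 1 ∧ 0 ≤ unitDet p p' t ∧ 0 ≤ unitDet q q' t ∧ 0 ≤ unitDet r r' t := by
  have hcos : ∀ {x : ℝ}, |x| ≤ 1 → cos (arccos x) = x := fun h =>
    cos_arccos (abs_le.1 h).1 (abs_le.1 h).2
  have hmem : ∀ x, arccos x ∈ Set.Icc 0 π := fun x => ⟨arccos_nonneg x, arccos_le_pi x⟩
  have := exists_unitDet_nonneg_of_angles (hmem p) (hmem q) (hmem r) (hmem p') (hmem q') (hmem r')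
  rw [hcos hp, hcos hq, hcos hr, hcos hp', hcos hq', hcos hr'] at this
  exact this h₁ h₂ h₃ h₄

end Angles

/-! ### Unit diagonal, and the criterion via extension to a 2-group -/

section Normalization

variable {n k : ℕ}

/-- Rescale by $x_i=\sqrt{B_{ii}}$, which is positive by testing on basis vectors; rescaling
coordinates preserves sparsity. -/
theorem exists_normalization {B : Fin n → Fin n → ℝ} (hk : 1 ≤ k) (hsymm : ∀ i j, B i j = B j i)
    (hpos : ∀ v : Fin n → ℝ, v ≠ 0 → (Finset.univ.filter fun i => v i ≠ 0).card ≤ k →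
      0 < ∑ i, ∑ j, B i j * (v i * v j)) :
    ∃ (x : Fin n → ℝ) (b : Fin n → Fin n → ℝ), (∀ i, 0 < x i) ∧ (∀ i j, b i j = b j i) ∧
      (∀ i, b i i = 1) ∧ (∀ i j, B i j = x i * x j * b i j) ∧
      ∀ v : Fin n → ℝ, v ≠ 0 → (Finset.univ.filter fun i => v i ≠ 0).card ≤ k →
        0 < ∑ i, ∑ j, b i j * (v i * v j) := by
  classical
  have hdiag : ∀ i, 0 < B i i := by
    intro i
    have := hpos (Pi.single i 1) (by simp) (by
      refine le_trans (Finset.card_le_card (t := {i}) fun j hj => ?_) (by simpa using hk)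
      by_contra h
      simp [Pi.single_apply, Finset.mem_singleton.not.1 h] at hj)
    simpa [Pi.single_apply] using this
  have hx : ∀ i, 0 < √(B i i) := fun i => Real.sqrt_pos.2 (hdiag i)
  refine ⟨fun i => √(B i i), fun i j => B i j / (√(B i i) * √(B j j)), hx, fun i j => ?_,
    fun i => ?_, fun i j => ?_, fun v hv hc => ?_⟩
  · change B i j / _ = B j i / _
    rw [hsymm, mul_comm]
  · change B i i / _ = 1
    rw [Real.mul_self_sqrt (hdiag i).le, div_self (hdiag i).ne']
  · have := hx i
    have := hx j
    field_simp
  · have := hpos (fun i => v i / √(B i i)) ?_ ?_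
    · refine this.trans_eq (Finset.sum_congr rfl fun i _ => Finset.sum_congr rfl fun j _ => ?_)
      have := hx i
      have := hx j
      field_simp
    · obtain ⟨i, hi⟩ := Function.ne_iff.1 hv
      exact Function.ne_iff.2 ⟨i, div_ne_zero hi (hx i).ne'⟩
    · simpa [(hx _).ne'] using hc

theorem abs_lt_one_of_sparse_pos {b : Fin n → Fin n → ℝ} (hk : 2 ≤ k)
    (hsymm : ∀ i j, b i j = b j i) (hdiag : ∀ i, b i i = 1)
    (hpos : ∀ v : Fin n → ℝ, v ≠ 0 → (Finset.univ.filter fun i => v i ≠ 0).card ≤ k →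
      0 < ∑ i, ∑ j, b i j * (v i * v j)) {i j : Fin n} (hij : i ≠ j) : |b i j| < 1 := by
  classical
  have key : ∀ c : ℝ, 0 < 1 + c ^ 2 + 2 * b i j * c := by
    intro c
    have := hpos (Pi.single i 1 + Pi.single j c)
      (Function.ne_iff.2 ⟨i, by simp [hij]⟩) (by
        refine le_trans (Finset.card_le_card (t := {i, j}) fun l hl => ?_)
          (Finset.card_le_two.trans hk)
        by_contra h
        simp only [Finset.mem_insert, Finset.mem_singleton, not_or] at h
        simp [Pi.single_apply, h.1, h.2] at hl)
    simp only [Pi.add_apply, Pi.single_apply, mul_add, add_mul, Finset.sum_add_distrib, ite_mul,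
      mul_ite, mul_zero, zero_mul, mul_one, one_mul, Finset.sum_ite_eq', Finset.mem_univ, if_true,
      hdiag, hsymm j i] at this
    linarith
  rw [abs_lt]
  constructor
  · linarith [key 1]
  · linarith [key (-1)]

theorem unitDet_nonneg_of_sparse_pos {b : Fin n → Fin n → ℝ} (hk : 3 ≤ k)
    (hsymm : ∀ i j, b i j = b j i) (hdiag : ∀ i, b i i = 1)
    (hpos : ∀ v : Fin n → ℝ, v ≠ 0 → (Finset.univ.filter fun i => v i ≠ 0).card ≤ k →
      0 < ∑ i, ∑ j, b i j * (v i * v j)) {i j l : Fin n} (hij : i ≠ j) :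
    0 ≤ unitDet (b i j) (b i l) (b j l) := by
  classical
  refine unitDet_nonneg_of_form
    (abs_lt_one_of_sparse_pos (by linarith) hsymm hdiag hpos hij) fun x y z => ?_
  have : 0 ≤ ∑ r, ∑ s, b r s * ((Pi.single i x + Pi.single j y + Pi.single l z : Fin n → ℝ) r *
      (Pi.single i x + Pi.single j y + Pi.single l z : Fin n → ℝ) s) := by
    by_cases h0 : (Pi.single i x + Pi.single j y + Pi.single l z : Fin n → ℝ) = 0
    · rw [h0]; simp
    · refine (hpos _ h0 ?_).le
      refine le_trans (Finset.card_le_card (t := {i, j, l}) fun m hm => ?_)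
        (Finset.card_le_three.trans hk)
      by_contra h
      simp only [Finset.mem_insert, Finset.mem_singleton, not_or] at h
      simp [Pi.single_apply, h.1, h.2.1, h.2.2] at hm
  simp only [Pi.add_apply, Pi.single_apply, mul_add, add_mul, Finset.sum_add_distrib, ite_mul,
    mul_ite, mul_zero, zero_mul, Finset.sum_ite_eq', Finset.mem_univ, if_true,
    hdiag, hsymm j i, hsymm l i, hsymm l j] at this
  linarith

/-- If a normalized dual form extends to a function on an elementary abelian `2`-group, then
multiplication by powers of a diagonal form creates no new sums of squares of `k`-nomials. -/
theorem isSumSqKNomials_of_forall_exists_extension {H : Type*} [AddCommGroup H]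
    {h : Fin n → H} (hh : ∀ i, h i + h i = 0) (hk : 1 ≤ k)
    (hext : ∀ b : Fin n → Fin n → ℝ, (∀ i j, b i j = b j i) → (∀ i, b i i = 1) →
      (∀ v : Fin n → ℝ, v ≠ 0 → (Finset.univ.filter fun i => v i ≠ 0).card ≤ k →
        0 < ∑ i, ∑ j, b i j * (v i * v j)) →
      ∃ g : H → ℝ, IsSparsePSD k g ∧ ∀ i j, g (h i + h j) = b i j)
    {p : MvPolynomial (Fin n) ℝ} (hp : p.IsHomogeneous 2) {l : Fin n → ℝ} (hl : l ≠ 0) {r : ℕ}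
    (hs : IsSumSqKNomials k (weightedSumSqVars l ^ r * p)) : IsSumSqKNomials k p := by
  obtain ⟨A, hA, rfl⟩ := exists_symm_eq_quadForm hp
  by_contra hnot
  obtain ⟨B, hB, hpos, hneg⟩ := exists_dual hA hnot
  obtain ⟨x, b, hx, hb, hb1, hBb, hbpos⟩ := exists_normalization hk hB hpos
  obtain ⟨g, hg, hgb⟩ := hext b hb hb1 hbpos
  have := hg.sum_nonneg hh hx hl hs
  simp only [hgb, ← hBb] at this
  exact hneg.not_ge this

end Normalization

/-! ### The case $k=2$ -/

section Binomials

variable {n : ℕ}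

theorem single_add_single_support {i j : Fin n} (hij : i ≠ j) :
    (Finset.univ.filter fun l => (Pi.single i 1 + Pi.single j 1 : Fin n → ZMod 2) l ≠ 0)
      = {i, j} := by
  ext l
  simp only [Finset.mem_filter, Finset.mem_univ, true_and, Pi.add_apply, Pi.single_apply,
    Finset.mem_insert, Finset.mem_singleton]
  by_cases h1 : l = i
  · subst h1; simp [hij]
  · simp [h1]

theorem isSumSqKNomials_two_of_weighted {p : MvPolynomial (Fin n) ℝ} (hp : p.IsHomogeneous 2)
    {l : Fin n → ℝ} (hl : l ≠ 0) {r : ℕ}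
    (hs : IsSumSqKNomials 2 (weightedSumSqVars l ^ r * p)) : IsSumSqKNomials 2 p := by
  classical
  have h2 : ∀ a : Fin n → ZMod 2, a + a = 0 := fun a => funext fun i => CharTwo.add_self_eq_zero _
  refine isSumSqKNomials_of_forall_exists_extension (h := fun i => Pi.single i (1 : ZMod 2))
    (fun i => h2 _) one_le_two (fun b hb hb1 hpos => ?_) hp hl hs
  -- The value $0$ elsewhere is harmless, since only $|g|\le1$ is needed. The choice of pair is
  -- immaterial: $e_i+e_j$ determines $\{i,j\}$ and $b$ is symmetric.
  let g : (Fin n → ZMod 2) → ℝ := fun a =>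
    if a = 0 then 1 else
      if h : ∃ e : Fin n × Fin n, e.1 ≠ e.2 ∧ a = Pi.single e.1 1 + Pi.single e.2 1
      then b h.choose.1 h.choose.2 else 0
  refine ⟨g, isSparsePSD_two h2 (by simp [g]) fun a => ?_, fun i j => ?_⟩
  · simp only [g]
    split_ifs with h0 h
    · simp
    · exact (abs_lt_one_of_sparse_pos le_rfl hb hb1 hpos h.choose_spec.1).le
    · simp
  · by_cases hij : i = j
    · subst hij
      simp [g, h2, hb1]
    · have h0 : (Pi.single i 1 + Pi.single j 1 : Fin n → ZMod 2) ≠ 0 :=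
        Function.ne_iff.2 ⟨i, by simp [hij]⟩
      have h : ∃ e : Fin n × Fin n, e.1 ≠ e.2 ∧
          (Pi.single i 1 + Pi.single j 1 : Fin n → ZMod 2) = Pi.single e.1 1 + Pi.single e.2 1 :=
        ⟨(i, j), hij, rfl⟩
      simp only [g, if_neg h0, dif_pos h]
      obtain ⟨h1, h3⟩ := h.choose_spec
      have h4 := single_add_single_support h1
      rw [← h3, single_add_single_support hij] at h4
      generalize h.choose = e at h1 h4
      have hi : i = e.1 ∨ i = e.2 := by
        have : i ∈ ({e.1, e.2} : Finset (Fin n)) := h4 ▸ Finset.mem_insert_self i {j}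
        simpa using this
      have hj : j = e.1 ∨ j = e.2 := by
        have : j ∈ ({e.1, e.2} : Finset (Fin n)) := h4 ▸ by simp
        simpa using this
      rcases hi with hi | hi <;> rcases hj with hj | hj
      · exact absurd (hi.trans hj.symm) hij
      · rw [← hi, ← hj]
      · rw [← hi, ← hj, hb]
      · exact absurd (hi.trans hj.symm) hij

end Binomials

/-! ### The case $n=4$, $k=3$ -/

section Trinomials

/-- The seven two-dimensional subspaces of `𝔽₂³`, each given by two of its nonzero elements. -/
def fanoLines : List ((ZMod 2 × ZMod 2 × ZMod 2) × (ZMod 2 × ZMod 2 × ZMod 2)) :=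
  [((1, 0, 0), (0, 1, 0)), ((1, 0, 0), (0, 0, 1)), ((0, 1, 0), (0, 0, 1)), ((0, 1, 1), (1, 0, 1)),
    ((1, 0, 0), (0, 1, 1)), ((0, 1, 0), (1, 0, 1)), ((0, 0, 1), (1, 1, 0))]

set_option synthInstance.maxSize 1000 in
set_option synthInstance.maxHeartbeats 200000 in
theorem fanoLines_spec : ∀ a b : ZMod 2 × ZMod 2 × ZMod 2, a = 0 ∨ b = 0 ∨ a + b = 0 ∨
    ∃ l ∈ fanoLines,
      (a = l.1 ∧ b = l.2 ∧ a + b = l.1 + l.2) ∨ (a = l.2 ∧ b = l.1 ∧ a + b = l.1 + l.2) ∨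
      (a = l.1 ∧ b = l.1 + l.2 ∧ a + b = l.2) ∨ (a = l.1 + l.2 ∧ b = l.1 ∧ a + b = l.2) ∨
      (a = l.2 ∧ b = l.1 + l.2 ∧ a + b = l.1) ∨ (a = l.1 + l.2 ∧ b = l.2 ∧ a + b = l.1) := by
  decide

theorem unitDet_nonneg_of_fanoLines {g : ZMod 2 × ZMod 2 × ZMod 2 → ℝ} (h0 : g 0 = 1)
    (hl : ∀ l ∈ fanoLines, 0 ≤ unitDet (g l.1) (g l.2) (g (l.1 + l.2)))
    (a b : ZMod 2 × ZMod 2 × ZMod 2) : 0 ≤ unitDet (g a) (g b) (g (a + b)) := by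
  have h2 : ∀ a : ZMod 2 × ZMod 2 × ZMod 2, a + a = 0 := by decide
  rcases fanoLines_spec a b with rfl | rfl | h | ⟨l, hlm, h⟩
  · rw [zero_add, h0, unitDet]; ring_nf; rfl
  · rw [add_zero, h0, unitDet]; ring_nf; rfl
  · obtain rfl : a = b := add_right_cancel (h.trans (h2 b).symm)
    rw [h, h0, unitDet]; ring_nf; rfl
  · have := hl l hlm
    rcases h with h | h | h | h | h | h <;> rw [h.2.2, h.1, h.2.1] <;>
      refine this.trans_eq ?_ <;> unfold unitDet <;> ring

theorem isSumSqKNomials_three_of_weighted {p : MvPolynomial (Fin 4) ℝ} (hp : p.IsHomogeneous 2)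
    {l : Fin 4 → ℝ} (hl : l ≠ 0) {r : ℕ}
    (hs : IsSumSqKNomials 3 (weightedSumSqVars l ^ r * p)) : IsSumSqKNomials 3 p := by
  have h2 : ∀ a : ZMod 2 × ZMod 2 × ZMod 2, a + a = 0 := by decide
  refine isSumSqKNomials_of_forall_exists_extension
    (h := (![(1, 0, 0), (0, 1, 0), (0, 0, 1), 0] : Fin 4 → ZMod 2 × ZMod 2 × ZMod 2))
    (fun i => h2 _) (by norm_num) (fun b hb hb1 hpos => ?_) hp hl hs
  have habs : ∀ {i j : Fin 4}, i ≠ j → |b i j| ≤ 1 := fun hij =>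
    (abs_lt_one_of_sparse_pos (by norm_num) hb hb1 hpos hij).le
  have hdet : ∀ {i j : Fin 4} (m : Fin 4), i ≠ j → 0 ≤ unitDet (b i j) (b i m) (b j m) :=
    fun m hij => unitDet_nonneg_of_sparse_pos le_rfl hb hb1 hpos hij
  -- The four lines missing $(1,1,1)$ give exactly the $3\times3$ principal minors of $b$; the three
  -- lines through it constrain $t=g(1,1,1)$.
  have d₁ := hdet (i := 3) (j := 0) 1 (by decide)
  have d₂ := hdet (i := 3) (j := 0) 2 (by decide)
  have d₃ := hdet (i := 3) (j := 1) 2 (by decide)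
  have d₄ := hdet (i := 0) (j := 1) 2 (by decide)
  obtain ⟨t, ht, t₁, t₂, t₃⟩ := exists_unitDet_nonneg (p := b 3 0) (q := b 3 1) (r := b 3 2)
    (p' := b 1 2) (q' := b 0 2) (r' := b 0 1) (habs (by decide)) (habs (by decide))
    (habs (by decide)) (habs (by decide)) (habs (by decide)) (habs (by decide)) d₁ d₂ d₃
    (d₄.trans_eq (by unfold unitDet; ring))
  let g : ZMod 2 × ZMod 2 × ZMod 2 → ℝ := fun a =>
    if a = 0 then 1 else if a = (1, 0, 0) then b 3 0 else if a = (0, 1, 0) then b 3 1 else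
    if a = (0, 0, 1) then b 3 2 else if a = (0, 1, 1) then b 1 2 else
    if a = (1, 0, 1) then b 0 2 else if a = (1, 1, 0) then b 0 1 else t
  have g0 : g 0 = 1 := rfl
  have g1 : g (1, 0, 0) = b 3 0 := by simp [g]
  have g2 : g (0, 1, 0) = b 3 1 := by simp [g]
  have g3 : g (0, 0, 1) = b 3 2 := by simp [g]
  have g4 : g (0, 1, 1) = b 1 2 := by simp [g]
  have g5 : g (1, 0, 1) = b 0 2 := by simp [g]
  have g6 : g (1, 1, 0) = b 0 1 := by simp [g]
  have g7 : g (1, 1, 1) = t := by simp [g]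
  refine ⟨g, isSparsePSD_three h2 g0 (fun a => ?_) (unitDet_nonneg_of_fanoLines g0 ?_),
    fun i j => ?_⟩
  · simp only [g]
    split_ifs
    · simp
    all_goals first | exact ht | exact habs (by decide)
  · have e₁ : ((0, 1, 1) + (1, 0, 1) : ZMod 2 × ZMod 2 × ZMod 2) = (1, 1, 0) := by decide
    simp only [fanoLines, List.forall_mem_cons, List.not_mem_nil, false_imp_iff, implies_true,
      and_true, e₁]
    simp only [Prod.mk_add_mk, zero_add, add_zero, g1, g2, g3, g4, g5, g6, g7]
    refine ⟨d₁, d₂, d₃, d₄.trans_eq (by unfold unitDet; ring), t₁, t₂, t₃⟩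
  · fin_cases i <;> fin_cases j <;>
      simp [h2, g0, hb1, g1, g2, g3, g4, g5, g6, hb] <;> exact hb _ _

end Trinomials

/-! ### Symmetric quadratic forms -/

section Symmetric

variable {n k : ℕ}

theorem IsSumSqKNomials.eval_nonneg {f : MvPolynomial (Fin n) ℝ} (hf : IsSumSqKNomials k f)
    (x : Fin n → ℝ) : 0 ≤ eval x f := by
  obtain ⟨m, q, -, rfl⟩ := hf
  simp only [map_sum, map_pow]
  positivity

theorem isSumSqKNomials_of_eval_nonneg (hk : n ≤ k) {A : Fin n → Fin n → ℝ}
    (hA : ∀ i j, A i j = A j i) (h : ∀ x, 0 ≤ eval x (quadForm A)) :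
    IsSumSqKNomials k (quadForm A) := by
  have hpsd : (Matrix.of A).PosSemidef := by
    refine .of_dotProduct_mulVec_nonneg (Matrix.IsHermitian.ext fun i j => by simp [hA i j])
      fun x => (h x).trans_eq ?_
    rw [eval_quadForm]
    simp only [dotProduct, Matrix.mulVec, Finset.mul_sum, Matrix.of_apply, star_trivial]
    exact Finset.sum_congr rfl fun i _ => Finset.sum_congr rfl fun j _ => by ring
  obtain ⟨m, v, hv⟩ := Matrix.posSemidef_iff_eq_sum_vecMulVec.1 hpsd
  have hAv : A = ∑ s, fun i j => v s i * v s j := by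
    ext i j
    simpa [Matrix.sum_apply, Matrix.vecMulVec_apply, Finset.sum_apply] using
      congrFun (congrFun hv i) j
  rw [hAv, quadForm_sum]
  refine .sum _ _ fun s _ => ?_
  rw [quadForm_mul_self]
  exact (isKNomial_linear ((Finset.card_le_univ _).trans (by simpa using hk))).isSumSqKNomials_sq

theorem eval_sumSqVars_pos {x : Fin n → ℝ} (hx : x ≠ 0) : 0 < eval x (sumSqVars n) := by
  obtain ⟨i, hi⟩ := Function.ne_iff.1 hx
  simp only [sumSqVars, map_sum, map_pow, eval_X]
  exact Finset.sum_pos' (fun _ _ => sq_nonneg _) ⟨i, Finset.mem_univ i, sq_pos_of_ne_zero hi⟩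

theorem eval_quadForm_nonneg_of_sumSqVars_pow_mul {A : Fin n → Fin n → ℝ} {r : ℕ}
    (hs : IsSumSqKNomials k (sumSqVars n ^ r * quadForm A)) (x : Fin n → ℝ) :
    0 ≤ eval x (quadForm A) := by
  by_cases hx : x = 0
  · rw [eval_quadForm, hx]; simp
  · have := hs.eval_nonneg x
    rw [map_mul, map_pow] at this
    exact (mul_nonneg_iff_of_pos_left (pow_pos (eval_sumSqVars_pos hx) r)).1 this

theorem exists_perm_apply_eq {α : Type*} [DecidableEq α] {a b c d : α} (hab : a ≠ b)
    (hcd : c ≠ d) : ∃ σ : Equiv.Perm α, σ a = c ∧ σ b = d := by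
  have hne : c ≠ Equiv.swap a c b := fun h =>
    hab ((Equiv.swap a c).injective ((Equiv.swap_apply_left a c).trans h))
  refine ⟨(Equiv.swap a c).trans (Equiv.swap (Equiv.swap a c b) d), ?_, by simp⟩
  simp [Equiv.swap_apply_of_ne_of_ne hne hcd]

/-- The sum of a symmetric dual form over all permutations of the variables. -/
theorem exists_invariant_dual {A : Fin n → Fin n → ℝ}
    (hA : ∀ (σ : Equiv.Perm (Fin n)) (i j), A (σ i) (σ j) = A i j)
    (hn : 2 ≤ n) (hnot : ¬ IsSumSqKNomials k (quadForm A)) :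
    ∃ d e : ℝ,
      (∀ v : Fin n → ℝ, (Finset.univ.filter fun i => v i ≠ 0).card ≤ k →
        0 ≤ ∑ i, ∑ j, (if i = j then d else e) * (v i * v j)) ∧
      ∑ i, ∑ j, A i j * (if i = j then d else e) < 0 := by
  classical
  obtain ⟨i₀, i₁, h01⟩ : ∃ i j : Fin n, i ≠ j :=
    ⟨⟨0, by omega⟩, ⟨1, by omega⟩, by simp⟩
  have hsymm : ∀ i j, A i j = A j i := fun i j => by
    have := hA (Equiv.swap i j) j i
    simpa using this
  obtain ⟨B, hB, hpos, hneg⟩ := exists_dual hsymm hnot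
  let B' : Fin n → Fin n → ℝ := fun i j => ∑ σ : Equiv.Perm (Fin n), B (σ i) (σ j)
  have hinv : ∀ (τ : Equiv.Perm (Fin n)) (i j), B' (τ i) (τ j) = B' i j := fun τ i j =>
    Fintype.sum_equiv (Equiv.mulRight τ) _ _ fun _ => rfl
  have hB' : ∀ i j, B' i j = if i = j then B' i₀ i₀ else B' i₀ i₁ := by
    intro i j
    split_ifs with h
    · subst h
      simpa using hinv (Equiv.swap i₀ i) i₀ i₀
    · obtain ⟨σ, rfl, rfl⟩ := exists_perm_apply_eq h01 h
      exact hinv σ _ _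
  refine ⟨B' i₀ i₀, B' i₀ i₁, fun v hv => ?_, ?_⟩
  · simp only [← hB']
    have : ∑ i, ∑ j, B' i j * (v i * v j)
        = ∑ σ : Equiv.Perm (Fin n), ∑ i, ∑ j, B i j * (v (σ.symm i) * v (σ.symm j)) := by
      simp only [B', Finset.sum_mul]
      rw [Finset.sum_congr rfl fun i _ => Finset.sum_comm, Finset.sum_comm]
      refine Finset.sum_congr rfl fun σ _ => ?_
      refine Fintype.sum_equiv σ _ _ fun i => Fintype.sum_equiv σ _ _ fun j => by simp
    rw [this]
    refine Finset.sum_nonneg fun σ _ => ?_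
    by_cases h0 : (fun i => v (σ.symm i)) = 0
    · have : ∀ i, v (σ.symm i) = 0 := congrFun h0
      simp [this]
    · refine (hpos _ h0 (le_trans (le_of_eq ?_) hv)).le
      exact Finset.card_bij (fun i _ => σ.symm i) (by simp) (by simp)
        fun i hi => ⟨σ i, by simpa using hi, by simp⟩
  · simp only [← hB']
    have : ∑ i, ∑ j, A i j * B' i j
        = ∑ σ : Equiv.Perm (Fin n), ∑ i, ∑ j, A i j * B i j := by
      simp only [B', Finset.mul_sum]
      rw [Finset.sum_congr rfl fun i _ => Finset.sum_comm, Finset.sum_comm]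
      refine Finset.sum_congr rfl fun σ _ => ?_
      refine Fintype.sum_equiv σ _ _ fun i => Fintype.sum_equiv σ _ _ fun j => by rw [hA]
    rw [this]
    exact Finset.sum_neg (fun _ _ => hneg) ⟨1, Finset.mem_univ _⟩

/-- As $s+t=0$ only when $s=t$, any $k\le n$ elements of $H$ give a principal submatrix of the
$n\times n$ matrix with entries $d$ and $e$. -/
theorem isSparsePSD_ite {H : Type*} [AddCommGroup H] [DecidableEq H] (h2 : ∀ a : H, a + a = 0)
    (hk : k ≤ n) {d e : ℝ}
    (h : ∀ v : Fin n → ℝ, (Finset.univ.filter fun i => v i ≠ 0).card ≤ k →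
      0 ≤ ∑ i, ∑ j, (if i = j then d else e) * (v i * v j)) :
    IsSparsePSD k fun a : H => if a = 0 then d else e := by
  classical
  intro S a hS
  have heq : ∀ s t : H, s + t = 0 ↔ s = t := fun s t =>
    ⟨fun h => add_right_cancel (h.trans (h2 t).symm), fun h => h ▸ h2 s⟩
  obtain ⟨φ⟩ : Nonempty (S ↪ Fin n) :=
    Function.Embedding.nonempty_of_card_le (by simpa using hS.trans hk)
  let v : Fin n → ℝ := Function.extend φ (fun s => a s) fun _ => 0
  have hv0 : ∀ i, i ∉ Set.range φ → v i = 0 := fun i hi =>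
    Function.extend_apply' _ _ _ hi
  have hv : ∀ s, v (φ s) = a s := fun s => φ.injective.extend_apply _ _ _
  refine (h v ?_).trans_eq ?_
  · refine (Finset.card_le_card (t := Finset.univ.map φ) fun i hi => ?_).trans (by simpa using hS)
    by_contra hne
    exact (Finset.mem_filter.1 hi).2 (hv0 i (by simpa using hne))
  · simp only [heq]
    rw [← Finset.sum_coe_sort S]
    refine (Fintype.sum_of_injective φ φ.injective _ _ (fun i hi => by simp [hv0 i hi])
      fun s => ?_).symm
    rw [← Finset.sum_coe_sort S]
    refine Fintype.sum_of_injective φ φ.injective _ _ (fun i hi => by simp [hv0 i hi])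
      fun t => ?_
    simp only [hv, φ.injective.eq_iff, Subtype.ext_iff]
    ring

theorem isSumSqKNomials_of_isSymmetric {p : MvPolynomial (Fin n) ℝ} (hp : p.IsHomogeneous 2)
    (hsymm : p.IsSymmetric) {r : ℕ} (hs : IsSumSqKNomials k (sumSqVars n ^ r * p)) :
    IsSumSqKNomials k p := by
  classical
  obtain ⟨A, hA, rfl⟩ := exists_invariant_eq_quadForm hp hsymm
  rcases le_or_gt n k with hnk | hnk
  -- For $k\ge n$ sparsity is no restriction on linear forms, so pointwise nonnegativity suffices.
  · refine isSumSqKNomials_of_eval_nonneg hnk (fun i j => ?_)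
      (eval_quadForm_nonneg_of_sumSqVars_pow_mul hs)
    simpa using hA (Equiv.swap i j) j i
  rcases Nat.eq_zero_or_pos k with rfl | hk
  · have hG : sumSqVars n ≠ 0 := fun h => by
      have := eval_sumSqVars_pos (n := n) (x := 1) (Function.ne_iff.2 ⟨⟨0, hnk⟩, by simp⟩)
      simp [h] at this
    have := (mul_eq_zero.1 hs.eq_zero_of_zero).resolve_left (pow_ne_zero r hG)
    rw [this]
    exact .zero
  by_contra hnot
  obtain ⟨d, e, hpos, hneg⟩ := exists_invariant_dual hA (by omega) hnot
  have h2 : ∀ a : Fin n → ZMod 2, a + a = 0 := fun a => funext fun i => CharTwo.add_self_eq_zero _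
  rw [← weightedSumSqVars_one] at hs
  have := (isSparsePSD_ite h2 hnk.le hpos).sum_nonneg
    (h := fun i => Pi.single i (1 : ZMod 2)) (fun i => h2 _) (x := fun _ => 1)
    (fun _ => one_pos) (l := 1) (Function.ne_iff.2 ⟨⟨0, by omega⟩, by simp⟩) hs
  have heq : ∀ i j : Fin n, (Pi.single i 1 + Pi.single j 1 : Fin n → ZMod 2) = 0 ↔ i = j := by
    refine fun i j => ⟨fun h => ?_, fun h => h ▸ h2 _⟩
    by_contra hij
    simpa [hij] using congrFun h i
  simp only [heq, mul_one, one_mul] at this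
  exact hneg.not_ge this

end Symmetric

/-! ### Assembling the theorem -/

theorem isSumSqKNomials_iff_of_forall_imp {n k : ℕ} {p : MvPolynomial (Fin n) ℝ}
    (h : ∀ r, IsSumSqKNomials k (sumSqVars n ^ r * p) → IsSumSqKNomials k p) :
    ((∃ r : ℕ, IsSumSqKNomials k (sumSqVars n ^ r * p)) ↔ IsSumSqKNomials k p) ∧
      (∀ r : ℕ, IsSumSqKNomials k (sumSqVars n ^ r * p) ↔ IsSumSqKNomials k p) :=
  ⟨⟨fun ⟨r, hr⟩ => h r hr, fun hp => ⟨0, by simpa using hp⟩⟩,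
    fun r => ⟨h r, fun hp => by
      simpa only [weightedSumSqVars_one] using hp.weightedSumSqVars_pow_mul 1 r⟩⟩

theorem theorem1 :
    (∀ (n k : ℕ) (p : MvPolynomial (Fin n) ℝ), p.IsHomogeneous 2 →
      (p.IsSymmetric ∨ k = 2 ∨ (n = 4 ∧ k = 3)) →
        ((∃ r : ℕ, IsSumSqKNomials k (sumSqVars n ^ r * p)) ↔ IsSumSqKNomials k p) ∧
        (∀ r : ℕ, IsSumSqKNomials k (sumSqVars n ^ r * p) ↔ IsSumSqKNomials k p)) ∧
    (∀ q : MvPolynomial (Fin 4) ℝ, q.IsHomogeneous 2 →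
      ∀ l : Fin 4 → ℝ, l ≠ 0 → ∀ r : ℕ,
        (IsSumSqKNomials 3 (weightedSumSqVars l ^ r * q) ↔ IsSumSqKNomials 3 q)) := by
  refine ⟨fun n k p hp hcase => isSumSqKNomials_iff_of_forall_imp fun r hr => ?_,
    fun q hq l hl r => ⟨isSumSqKNomials_three_of_weighted hq hl,
      fun h => h.weightedSumSqVars_pow_mul l r⟩⟩
  rcases hcase with hsymm | rfl | ⟨rfl, rfl⟩
  · exact isSumSqKNomials_of_isSymmetric hp hsymm hr
  -- With no variables the weight vector $1$ equals $0$, so $n=0$ is treated apart; there $p=0$.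
  · rcases n with _ | n
    · obtain ⟨A, rfl⟩ := exists_eq_quadForm hp
      simpa [quadForm] using IsSumSqKNomials.zero
    · rw [← weightedSumSqVars_one] at hr
      exact isSumSqKNomials_two_of_weighted hp one_ne_zero hr
  · rw [← weightedSumSqVars_one] at hr
    exact isSumSqKNomials_three_of_weighted hp one_ne_zero hr
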